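/- Graphs are finite and simple. For a set $W$ of vertices of a graph $G$, the boundary $\partial(W)$ is the set of edges of $G$ with precisely one end-vertex in $W$; for a subgraph $H$, $\partial(H)=\partial(V(H))$. A $3$-edge-cut is a set of exactly three edges of the form $\partial(W)$. A $2$-factor is a spanning subgraph in which every vertex has degree $2$. A collection $\mathcal H$ of induced subgraphs of $G$ is a good collection if all its members have the same number $n_{\mathcal H}$ of vertices and the same number $b_{\mathcal H}\in\{2,4,5,6,7,9\}$ of boundary edges; put $a_{\mathcal H}=2\lfloor b_{\mathcal H}/2\rfloor$. For a $2$-factor $F$, let $\mathcal H^k(F)$ be the set of those $H\in\mathcal H$ that have exactly $k$ boundary edges in $F$, let $\mathcal H^*(F)=\mathcal H^{a_{\mathcal H}}(F)$, and let $V\mathcal H^0(F)$ be the union of the vertex sets of the members of $\mathcal H^0(F)$. Let $G$ be a bridgeless cubic graph (not necessarily connected), let $r$ be a real number, and let $\mathcal I$ be a set of good collections of induced subgraphs of $G$. For each $\mathcal H\in\mathcal I$ let $p_{\mathcal H}\ge 0$, $s_{\mathcal H}$ and $t_{\mathcal H}$ be real numbers such that $$ r \;\ge\; \frac{\left(1.5\,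 a_{\mathcal H}-b_{\mathcal H}\right) s_{\mathcal H}+\frac{p_{\mathcal H}}{n_{\mathcal H}}\, b_{\mathcal H}\, t_{\mathcal H}}{\left(1.5\, a_{\mathcal H}-b_{\mathcal H}\right)+\frac{p_{\mathcal H}}{n_{\mathcal H}}\, b_{\mathcal H}} . $$ Then there exists a $2$-factor $F$ of $G$ that contains an edge of each $3$-edge-cut of $G$ and such that every function $c:V(G)\to\mathbb R$ satisfying (i) $c(v)\le s_{\mathcal H}$ for each $\mathcal H\in\mathcal I$ and each $v\in V\mathcal H^0(F)$, and $c(v)\le r$ for every vertex $v$ that lies in none of the sets $V\mathcal H^0(F)$, $\mathcal H\in\mathcal I$; and (ii) there are pairwise disjoint sets $S_{\mathcal H}\subseteq V(G)$, $\mathcal H\in\mathcal I$, such that $|S_{\mathcal H}|\ge p_{\mathcal H}\cdot|\mathcal H^*(F)|$ and $c(v)\le t_{\mathcal H}$ for each $v\in S_{\mathcal H}$, also satisfies $$\sum_{v\in V(G)} c(v)\;\le\; r\cdot|V(G)| .$$ -/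

import Mathlib

namespace CubicTSP

/-- No edge of the graph is a bridge.  (Mathlib's `IsBridge` also makes sense for pairs that are
not edges, so the quantifier ranges over the edges only.) -/
def IsBridgeless {V : Type*} (G : SimpleGraph V) : Prop :=
  ∀ e ∈ G.edgeSet, ¬ G.IsBridge e

/-- The boundary of a vertex set `W`: the edges with precisely one end-vertex in `W`. -/
def boundary {V : Type*} (G : SimpleGraph V) (W : Set V) : Set (Sym2 V) :=
  {e | ∃ u v : V, u ∈ W ∧ v ∉ W ∧ G.Adj u v ∧ e = s(u, v)}

/-- A `k`-edge-cut: the boundary of some vertex set, consisting of exactly `k` edges. -/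
def IsEdgeCut {V : Type*} (G : SimpleGraph V) (k : ℕ) (X : Set (Sym2 V)) : Prop :=
  (∃ W : Set V, X = boundary G W) ∧ X.ncard = k

/-- A 2-factor: a spanning subgraph in which every vertex has degree 2. -/
def IsTwoFactor {V : Type*} {G : SimpleGraph V} (F : G.Subgraph) : Prop :=
  F.IsSpanning ∧ ∀ v : V, (F.neighborSet v).ncard = 2

/-- `𝓗` is a good collection of induced subgraphs of `G`, every member having `n` vertices
and `b` boundary edges. -/
def IsGoodCollection {V : Type*} (G : SimpleGraph V) (𝓗 : Set G.Subgraph) (n b : ℕ) : Prop :=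
  b ∈ ({2, 4, 5, 6, 7, 9} : Set ℕ) ∧
    ∀ H ∈ 𝓗, H.IsInduced ∧ H.verts.ncard = n ∧ (boundary G H.verts).ncard = b

/-- The members of `𝓗` that have exactly `k` boundary edges in `F`. -/
def withBoundaryIn {V : Type*} {G : SimpleGraph V} (F : G.Subgraph) (𝓗 : Set G.Subgraph)
    (k : ℕ) : Set G.Subgraph :=
  {H ∈ 𝓗 | (boundary G H.verts ∩ F.edgeSet).ncard = k}

/-- The union of the vertex sets of the members of `𝓗`. -/
def vertexUnion {V : Type*} {G : SimpleGraph V} (𝓗 : Set G.Subgraph) : Set V :=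
  {v | ∃ H ∈ 𝓗, v ∈ H.verts}

/-- The number `2 ⌊b / 2⌋`. -/
def evenFloor (b : ℕ) : ℕ := 2 * (b / 2)

end CubicTSP

/-!
Write `d(W)` for the size of the boundary of `W`.  Let `M` be a perfect matching with complement
`F`, and let a member `H` of a collection with `b` boundary edges have `x` of them in `F`.  Then
`x` is even, and for the admitted values of `b` every even `x < a = 2 ⌊b / 2⌋` satisfies
`x ≤ 2b / 3`.  Hence the nonlinear contribution of `H` to `∑ (c v - r)`, namely
`n (s - r)` if `x = 0`, `-p (r - t)` if `x = a` and `0` otherwise, is at most the linear function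
`n (s - r) / b * (b - 1.5 x)` of `x` (`contribution_le`; the hypothesis on `r` is exactly what is
needed at `x = a`).  Only the collections with `s > r` matter (`sum_sub_le`), so these linear
functions have nonnegative coefficients, and it suffices to find a perfect matching that contains
at most a third of the total weight for a nonnegative combination of cuts
(`exists_perfect_crossing_le`).  The 3-edge-cuts are handled by giving them a large extra weight:
a perfect matching meets each of them in an odd number of edges, so an average of one forces
exactly one (`exists_perfect_crossing_le_of_three_cut`).

That such a perfect matching exists follows from Edmonds' description of the perfect matching
polytope.  Here it is derived from `exists_matching_weight_ge`: for all nonnegative integer edge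
weights, a bridgeless cubic graph has a matching with at least a third of the total weight.
Subtracting the given weights from a large constant makes the matching perfect and reverses the
inequality.  The proof of `exists_matching_weight_ge` is Schrijver's induction for the
Cunningham–Marsh formula, run directly on this inequality instead of on dual solutions.  If some
vertex `u` is covered by all maximum-weight matchings, lower the weights at `u` by one: the maximum
drops by at least one and the total by at most three.  Otherwise lower the weights by one on a
component `C` of the support.  A matching that is optimal for the new weights, and among these
covers as much of `C` as possible, misses at most one vertex of `C` (`exists_near_perfect`),
because "no such matching misses both `u` and `v`" is a transitive relation by an
alternating-path exchange (`exists_switch`).  As odd sets have at least three boundary edges, `C`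
spans at most three times as many edges as that matching has in `C`.

Matchings are encoded as involutions, and alternating paths are the orbits of the group generated
by two of them.
-/

open Finset

namespace CubicTSP

/-! ### Two involutions and matchings -/

theorem even_card_of_involution {α : Type*} (A : Finset α) (g : α → α)
    (hmem : ∀ a ∈ A, g a ∈ A) (hinv : ∀ a ∈ A, g (g a) = a) (hne : ∀ a ∈ A, g a ≠ a) :
    Even #A := by
  have h : ∑ _a ∈ A, (1 : ZMod 2) = 0 :=
    Finset.sum_involution (fun a _ => g a) (fun _ _ => by decide) (fun a ha _ => hne a ha)
      hmem hinv
  rw [← ZMod.natCast_eq_zero_iff_even]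
  simpa using h

section Involutions

variable {V : Type*} {m n : Equiv.Perm V}

/-- The two involutions generate a dihedral group, in which `n` inverts `n * m`. -/
theorem apply_zpow_of_fixed (hm : ∀ v, m (m v) = v) (hn : ∀ v, n (n v) = v) {t : V}
    (ht : n t = t) (k : ℤ) : n (((n * m) ^ k) t) = ((n * m) ^ (-k)) t := by
  have hn' : n⁻¹ = n := by ext v; rw [Equiv.Perm.inv_eq_iff_eq]; exact (hn v).symm
  have hm' : m⁻¹ = m := by ext v; rw [Equiv.Perm.inv_eq_iff_eq]; exact (hm v).symm
  have h : n * (n * m) * n⁻¹ = (n * m)⁻¹ := by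
    rw [mul_inv_rev, hm', hn']; ext v; simp [hn]
  have h2 : n * (n * m) ^ k * n⁻¹ = (n * m) ^ (-k) := by
    rw [← conj_zpow, h, inv_zpow, zpow_neg]
  rw [← h2]
  simp [hn', ht]

theorem apply_zpow_of_fixed' (hm : ∀ v, m (m v) = v) (hn : ∀ v, n (n v) = v) {t : V}
    (ht : n t = t) (k : ℤ) : m (((n * m) ^ k) t) = ((n * m) ^ (-(1 + k))) t := by
  rw [← apply_zpow_of_fixed hm hn ht, zpow_add, zpow_one]
  simp [hn]

theorem sameCycle_apply_right_of_fixed (hm : ∀ v, m (m v) = v) (hn : ∀ v, n (n v) = v) {t x : V}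
    (ht : n t = t) (hx : (n * m).SameCycle t x) :
    (n * m).SameCycle t (m x) ∧ (n * m).SameCycle t (n x) := by
  obtain ⟨k, rfl⟩ := hx
  exact ⟨⟨_, (apply_zpow_of_fixed' hm hn ht k).symm⟩, ⟨_, (apply_zpow_of_fixed hm hn ht k).symm⟩⟩

/-- An alternating path that starts at a vertex missed by `n` has at most one vertex missed
by `m`. -/
theorem eq_of_sameCycle_of_fixed (hm : ∀ v, m (m v) = v) (hn : ∀ v, n (n v) = v) {t u v : V}
    (ht : n t = t) (hu : (n * m).SameCycle t u) (hv : (n * m).SameCycle t v)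
    (hmu : m u = u) (hmv : m v = v) : u = v := by
  obtain ⟨j, rfl⟩ := hu
  obtain ⟨k, rfl⟩ := hv
  rw [apply_zpow_of_fixed' hm hn ht] at hmu hmv
  set σ := n * m
  have key : ∀ i l : ℤ, (σ ^ i) t = (σ ^ l) t ↔ σ ^ (i - l) ∈ MulAction.stabilizer _ t := by
    intro i l
    rw [MulAction.mem_stabilizer_iff, Equiv.Perm.smul_def, sub_eq_neg_add, zpow_add, zpow_neg,
      Equiv.Perm.mul_apply, Equiv.Perm.inv_eq_iff_eq]
  rw [key] at hmu hmv ⊢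
  -- The exponents fixing `t` form a group that contains `-(2j+1)` and `-(2k+1)`, hence also
  -- `-(2j+1)k + (2k+1)j = j - k`.
  have h3 := mul_mem (zpow_mem hmu k) (zpow_mem hmv (-j))
  rw [← zpow_mul, ← zpow_mul, ← zpow_add] at h3
  convert h3 using 2
  ring

end Involutions

section Matchings

variable {V : Type*}

/-- A matching in the support of the weight function `w`, encoded as the involution that swaps
the ends of each matching edge and fixes the uncovered vertices. -/
def IsMatchingPerm (w : V → V → ℕ) (f : Equiv.Perm V) : Prop :=
  ∀ v, f (f v) = v ∧ (f v ≠ v → 0 < w v (f v))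

/-- Twice the weight of a matching: every edge is counted from both ends. -/
def matchingWeight [Fintype V] (w : V → V → ℕ) (f : Equiv.Perm V) : ℕ := ∑ v, w v (f v)

theorem even_matchingWeight [Fintype V] {w : V → V → ℕ} (hsymm : ∀ u v, w u v = w v u)
    (hloop : ∀ v, w v v = 0) {f : Equiv.Perm V} (hf : ∀ v, f (f v) = v) :
    Even (matchingWeight w f) := by
  rw [← ZMod.natCast_eq_zero_iff_even, matchingWeight, Nat.cast_sum]
  refine Finset.sum_involution (fun a _ => f a) (fun a _ => ?_) (fun a _ h h' => h ?_)
    (by simp) (by simp [hf])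
  · rw [hf, hsymm (f a) a, ← two_mul]
    exact mul_eq_zero_of_left rfl _
  · rw [h', hloop, Nat.cast_zero]

/-- The permutation that agrees with `n` on `P` and with `m` off `P`. -/
def splice (P : V → Prop) [DecidablePred P] (m n : Equiv.Perm V) (hm : ∀ v, m (m v) = v)
    (hn : ∀ v, n (n v) = v) (hP : ∀ v, P v → P (m v) ∧ P (n v)) : Equiv.Perm V :=
  Function.Involutive.toPerm (fun v => if P v then n v else m v) (by
    intro v
    by_cases h : P v
    · simp [h, (hP v h).2, hn]
    · have : ¬ P (m v) := fun h' => h (by simpa [hm] using (hP _ h').1)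
      simp [h, this, hm])

theorem splice_apply (P : V → Prop) [DecidablePred P] (m n : Equiv.Perm V)
    (hm : ∀ v, m (m v) = v) (hn : ∀ v, n (n v) = v) (hP : ∀ v, P v → P (m v) ∧ P (n v)) (v : V) :
    splice P m n hm hn hP v = if P v then n v else m v := rfl

variable [DecidableEq V] [Fintype V]

/-- The vertices of `C` covered by a matching. -/
def covered (C : Finset V) (f : Equiv.Perm V) : Finset V := {v ∈ C | f v ≠ v}

/-- Switching `M` along the alternating path of `M` and `N` that starts at `t`. -/
theorem exists_switch {w w' : V → V → ℕ} {C : Finset V}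
    (hw : ∀ f, IsMatchingPerm w f → matchingWeight w f = matchingWeight w' f + #(covered C f))
    {M N : Equiv.Perm V} (hM : IsMatchingPerm w M) (hN : IsMatchingPerm w N)
    (hmax : ∀ f, IsMatchingPerm w f → matchingWeight w f ≤ matchingWeight w N)
    {t u v : V} (htC : t ∈ C) (ht : N t = t) (hu : M u = u) (hv : M v = v) (huv : u ≠ v) :
    ∃ M', IsMatchingPerm w M' ∧ M' t = t ∧ (M' u = u ∨ M' v = v) ∧
      matchingWeight w' M ≤ matchingWeight w' M' ∧
      matchingWeight w M ≤ matchingWeight w M' := by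
  classical
  have hM2 := fun v => (hM v).1
  have hN2 := fun v => (hN v).1
  set P : V → Prop := fun x => (N * M).SameCycle t x with hPdef
  have hP : ∀ v, P v → P (M v) ∧ P (N v) :=
    fun v hv => sameCycle_apply_right_of_fixed hM2 hN2 ht hv
  have htP : P t := Equiv.Perm.SameCycle.refl _ _
  set M' := splice P M N hM2 hN2 hP with hM'
  set N' := splice P N M hN2 hM2 (fun v h => (hP v h).symm) with hN'
  have aM : ∀ x, M' x = if P x then N x else M x := splice_apply P M N hM2 hN2 hP
  have aN : ∀ x, N' x = if P x then M x else N x := splice_apply P N M hN2 hM2 _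
  have hM'm : IsMatchingPerm w M' := by
    intro x
    refine ⟨Function.Involutive.toPerm_involutive _ x, ?_⟩
    rw [aM]; split_ifs
    exacts [(hN x).2, (hM x).2]
  have hN'm : IsMatchingPerm w N' := by
    intro x
    refine ⟨Function.Involutive.toPerm_involutive _ x, ?_⟩
    rw [aN]; split_ifs
    exacts [(hM x).2, (hN x).2]
  have hsum : matchingWeight w M' + matchingWeight w N' =
      matchingWeight w M + matchingWeight w N := by
    simp only [matchingWeight, ← sum_add_distrib]
    refine sum_congr rfl fun x _ => ?_
    rw [aM, aN]; split_ifs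
    exacts [add_comm _ _, rfl]
  -- Switching does not cover more of `C`: the orbit `P` has at most one vertex missed by `M`,
  -- while `t` is missed by `M'`.
  have hfix : #{x ∈ C | M x = x} ≤ #{x ∈ C | M' x = x} := by
    refine card_le_card_of_injOn (fun x => if P x then t else x) ?_ ?_
    · intro x hx
      simp only [coe_filter, Set.mem_ofPred_eq] at hx ⊢
      split_ifs with h
      · exact ⟨htC, by rw [aM, if_pos htP, ht]⟩
      · exact ⟨hx.1, by rw [aM, if_neg h, hx.2]⟩
    · intro x hx y hy hxy
      simp only [coe_filter, Set.mem_ofPred_eq] at hx hy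
      by_cases h : P x <;> by_cases h' : P y <;> simp only [h, h', if_true, if_false] at hxy
      · exact eq_of_sameCycle_of_fixed hM2 hN2 ht h h' hx.2 hy.2
      · exact absurd (hxy ▸ htP) h'
      · exact absurd (hxy ▸ htP) h
      · exact hxy
  have hcov : #(covered C M') ≤ #(covered C M) := by
    have h1 := card_filter_add_card_filter_not (s := C) (fun x => M x = x)
    have h2 := card_filter_add_card_filter_not (s := C) (fun x => M' x = x)
    simp only [covered, ne_eq]
    omega
  have h1 := hmax N' hN'm
  have h2 := hw M hM
  have h3 := hw M' hM'm
  refine ⟨M', hM'm, by rw [aM, if_pos htP, ht], ?_, by omega, by omega⟩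
  by_cases h : P u
  · refine Or.inr ?_
    have : ¬ P v := fun h' => huv (eq_of_sameCycle_of_fixed hM2 hN2 ht h h' hu hv)
    rw [aM, if_neg this, hv]
  · exact Or.inl (by rw [aM, if_neg h, hu])

/-- Two adjacent uncovered vertices can be matched with each other. -/
theorem exists_augment {w : V → V → ℕ} (hsymm : ∀ u v, w u v = w v u) (w' : V → V → ℕ)
    (hloop : ∀ v, w' v v = 0) {M : Equiv.Perm V} (hM : IsMatchingPerm w M) {u v : V}
    (hu : M u = u) (hv : M v = v) (huv : u ≠ v) (hpos : 0 < w u v) {C : Finset V} (huC : u ∈ C) :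
    ∃ M', IsMatchingPerm w M' ∧ matchingWeight w' M ≤ matchingWeight w' M' ∧
      #(covered C M) < #(covered C M') := by
  have e : ∀ x, x ≠ u → x ≠ v → (Equiv.swap u v * M) x = M x := by
    intro x hxu hxv
    rw [Equiv.Perm.mul_apply]
    apply Equiv.swap_apply_of_ne_of_ne
    · rw [← hu]; exact M.injective.ne hxu
    · rw [← hv]; exact M.injective.ne hxv
  have eu : (Equiv.swap u v * M) u = v := by simp [hu]
  have ev : (Equiv.swap u v * M) v = u := by simp [hv]
  refine ⟨Equiv.swap u v * M, ?_, ?_, ?_⟩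
  · intro x
    rcases eq_or_ne x u with rfl | hxu
    · rw [eu, ev]; exact ⟨rfl, fun _ => hpos⟩
    rcases eq_or_ne x v with rfl | hxv
    · rw [ev, eu]; exact ⟨rfl, fun _ => hsymm u x ▸ hpos⟩
    rw [e x hxu hxv, e]
    · exact hM x
    · rw [← hu]; exact M.injective.ne hxu
    · rw [← hv]; exact M.injective.ne hxv
  · refine sum_le_sum fun x _ => ?_
    rcases eq_or_ne x u with rfl | hxu
    · rw [hu, hloop]; exact Nat.zero_le _
    rcases eq_or_ne x v with rfl | hxv
    · rw [hv, hloop]; exact Nat.zero_le _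
    rw [e x hxu hxv]
  · refine card_lt_card ⟨fun x hx => ?_, fun h => ?_⟩
    · simp only [covered, mem_filter] at hx ⊢
      rw [e x (fun h => hx.2 (h ▸ hu)) (fun h => hx.2 (h ▸ hv))]
      exact hx
    · have : u ∈ covered C M := h (by
        rw [covered, mem_filter, eu]
        exact ⟨huC, huv.symm⟩)
      simp [covered, hu] at this

/-- The heart of the induction: if every vertex is missed by some matching of maximum weight and
`C` is a component of the support of `w`, then a matching that is optimal for the weights lowered
by one on `C` misses at most one vertex of `C`. -/
theorem exists_near_perfect {w w' : V → V → ℕ} (hsymm : ∀ u v, w u v = w v u)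
    (hloop' : ∀ v, w' v v = 0) {C : Finset V} {a : V}
    (hC : ∀ x, x ∈ C ↔ Relation.ReflTransGen (fun x y => 0 < w x y) a x)
    (hw : ∀ f, IsMatchingPerm w f → matchingWeight w f = matchingWeight w' f + #(covered C f))
    (hmiss : ∀ t, ∃ N, IsMatchingPerm w N ∧
      (∀ f, IsMatchingPerm w f → matchingWeight w f ≤ matchingWeight w N) ∧ N t = t) :
    ∃ M, IsMatchingPerm w M ∧
      (∀ f, IsMatchingPerm w f → matchingWeight w' f ≤ matchingWeight w' M) ∧
      ∀ u ∈ C, ∀ v ∈ C, M u = u → M v = v → u = v := by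
  classical
  have hid : IsMatchingPerm w (1 : Equiv.Perm V) := fun v => ⟨rfl, fun h => absurd rfl h⟩
  obtain ⟨M₁, hM₁, hmax₁⟩ := exists_max_image ({f | IsMatchingPerm w f} : Finset (Equiv.Perm V))
    (matchingWeight w') ⟨1, by simpa using hid⟩
  simp only [mem_filter, mem_univ, true_and] at hM₁ hmax₁
  obtain ⟨M, hM, hmax⟩ := exists_max_image
    ({f | IsMatchingPerm w f ∧ matchingWeight w' M₁ ≤ matchingWeight w' f} :
      Finset (Equiv.Perm V)) (fun f => #(covered C f)) ⟨M₁, by simpa using hM₁⟩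
  simp only [mem_filter, mem_univ, true_and] at hM hmax
  -- `O` is the set of matchings of maximum `w'`-weight covering as much of `C` as possible.
  let O : Equiv.Perm V → Prop := fun f => IsMatchingPerm w f ∧
    matchingWeight w' M₁ ≤ matchingWeight w' f ∧ #(covered C M) ≤ #(covered C f)
  let R : V → V → Prop := fun u v => u ≠ v → ∀ f, O f → ¬ (f u = u ∧ f v = v)
  have hRsymm : ∀ u v, R u v → R v u := fun u v h hne f hf hh => h hne.symm f hf hh.symm
  have hRtrans : ∀ u t v, t ∈ C → R u t → R t v → R u v := by
    rintro u t v ht h1 h2 huv f hf ⟨hfu, hfv⟩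
    obtain ⟨N, hN, hNmax, hNt⟩ := hmiss t
    obtain ⟨f', hf', hft, hor, hle', hle⟩ := exists_switch hw hf.1 hN hNmax ht hNt hfu hfv huv
    have hO : O f' := by
      refine ⟨hf', hf.2.1.trans hle', ?_⟩
      have e1 := hw f hf.1
      have e2 := hw f' hf'
      have e3 := hmax₁ f' hf'
      have := hf.2.1
      have := hf.2.2
      omega
    rcases eq_or_ne u t with rfl | hut
    · exact h2 huv f hf ⟨hfu, hfv⟩
    rcases eq_or_ne t v with rfl | htv
    · exact h1 huv f hf ⟨hfu, hfv⟩
    rcases hor with h | h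
    · exact h1 hut f' hO ⟨h, hft⟩
    · exact h2 htv f' hO ⟨hft, h⟩
  have hRadj : ∀ u v, u ∈ C → 0 < w u v → R u v := by
    rintro u v hu hpos huv f hf ⟨hfu, hfv⟩
    obtain ⟨f', hf', hle, hlt⟩ := exists_augment hsymm w' hloop' hf.1 hfu hfv huv hpos hu
    have := hmax f' ⟨hf', hf.2.1.trans hle⟩
    exact absurd (hf.2.2.trans_lt hlt) this.not_gt
  have hRa : ∀ x, Relation.ReflTransGen (fun x y => 0 < w x y) a x → R a x := by
    intro x hx
    induction hx with
    | refl => exact fun h => absurd rfl h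
    | tail hb hbc ih => exact hRtrans _ _ _ ((hC _).2 hb) ih (hRadj _ _ ((hC _).2 hb) hbc)
  refine ⟨M, hM.1, fun f hf => (hmax₁ f hf).trans hM.2, fun u hu v hv hMu hMv => ?_⟩
  by_contra huv
  exact hRtrans u a v ((hC a).2 .refl) (hRsymm _ _ (hRa u ((hC u).1 hu))) (hRa v ((hC v).1 hv))
    huv M ⟨hM.1, hM.2, le_rfl⟩ ⟨hMu, hMv⟩

end Matchings

/-! ### Cubic graphs and their cuts -/

theorem IsMatchingPerm.mono {V : Type*} {w w' : V → V → ℕ} (h : ∀ u v, 0 < w' u v → 0 < w u v)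
    {f : Equiv.Perm V} (hf : IsMatchingPerm w' f) : IsMatchingPerm w f :=
  fun v => ⟨(hf v).1, fun hv => h _ _ ((hf v).2 hv)⟩

section CubicGraphs

variable {V : Type*} (G : SimpleGraph V) [DecidableRel G.Adj]

theorem even_card_interedges_self (C : Finset V) : Even #(G.interedges C C) := by
  refine even_card_of_involution _ Prod.swap (fun x hx => ?_) (fun x _ => x.swap_swap)
    fun x hx h => ?_
  · rw [SimpleGraph.mem_interedges_iff] at hx ⊢
    exact ⟨hx.2.1, hx.1, hx.2.2.symm⟩
  · rw [SimpleGraph.mem_interedges_iff] at hx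
    exact hx.2.2.ne (congrArg Prod.snd h)

theorem card_neighbors_of_cubic [Fintype V] (hG : G.IsRegularOfDegree 3) (u : V) :
    #{v | G.Adj u v} = 3 := by
  rw [← hG u, ← G.card_neighborFinset_eq_degree, G.neighborFinset_eq_filter]

variable [Fintype V] [DecidableEq V]

theorem card_interedges_self_add_compl (hG : G.IsRegularOfDegree 3) (C : Finset V) :
    #(G.interedges C C) + #(G.interedges C Cᶜ) = 3 * #C := by
  have h : ∀ D : Finset V, #(G.interedges C D) = ∑ u ∈ C, #{v ∈ D | G.Adj u v} := by
    intro D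
    simp only [SimpleGraph.interedges, Rel.interedges, card_filter, sum_product]
  rw [h, h, ← sum_add_distrib, mul_comm, ← smul_eq_mul, ← sum_const]
  refine sum_congr rfl fun u _ => ?_
  rw [← card_neighbors_of_cubic G hG u, card_filter, card_filter, card_filter,
    sum_add_sum_compl]

theorem card_interedges_compl_ne_one (hG : IsBridgeless G) (C : Finset V) :
    #(G.interedges C Cᶜ) ≠ 1 := by
  intro h
  obtain ⟨⟨u, v⟩, huv⟩ := card_eq_one.1 h
  have hmem : (u, v) ∈ G.interedges C Cᶜ := huv ▸ mem_singleton_self _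
  rw [SimpleGraph.mem_interedges_iff] at hmem
  refine hG s(u, v) hmem.2.2 ?_
  rw [SimpleGraph.isBridge_iff]
  rintro ⟨p⟩
  have key : ∀ x y, (G.deleteEdges {s(u, v)}).Walk x y → x ∈ C → y ∈ C := by
    intro x y q
    induction q with
    | nil => exact id
    | cons hadj _ ih =>
      rename_i a b c _
      intro ha
      refine ih ?_
      by_contra hb
      rw [SimpleGraph.deleteEdges_adj] at hadj
      have : (a, b) ∈ G.interedges C Cᶜ := by
        rw [SimpleGraph.mem_interedges_iff]
        exact ⟨ha, mem_compl.2 hb, hadj.1⟩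
      rw [huv, mem_singleton, Prod.mk.injEq] at this
      exact hadj.2 (by simp [this.1, this.2])
  exact mem_compl.1 hmem.2.1 (key u v p hmem.1)

theorem three_le_card_interedges_compl (hG : G.IsRegularOfDegree 3) (hb : IsBridgeless G)
    {C : Finset V} (hC : Odd #C) : 3 ≤ #(G.interedges C Cᶜ) := by
  have h1 := card_interedges_self_add_compl G hG C
  have h2 := card_interedges_compl_ne_one G hb C
  obtain ⟨k, hk⟩ := even_card_interedges_self G C
  obtain ⟨l, hl⟩ := hC
  omega

end CubicGraphs

/-! ### A matching with a third of the weight -/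

section Induction

variable {V : Type*} [Fintype V]

theorem matchingWeight_add (w δ : V → V → ℕ) (f : Equiv.Perm V) :
    matchingWeight (fun x y => w x y + δ x y) f = matchingWeight w f + matchingWeight δ f :=
  sum_add_distrib

variable [DecidableEq V] (G : SimpleGraph V) [DecidableRel G.Adj]

/-- A bridgeless cubic graph has, for all nonnegative integer edge weights, a matching that carries
at least a third of the total weight.  Both sides count every edge from both ends. -/
theorem exists_matching_weight_ge (hG : G.IsRegularOfDegree 3) (hb : IsBridgeless G)
    (w : V → V → ℕ) (hsymm : ∀ u v, w u v = w v u) (hadj : ∀ u v, 0 < w u v → G.Adj u v) :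
    ∃ f, IsMatchingPerm w f ∧ ∑ u, ∑ v, w u v ≤ 3 * matchingWeight w f := by
  classical
  have hid : IsMatchingPerm w (1 : Equiv.Perm V) := fun v => ⟨rfl, fun h => absurd rfl h⟩
  induction hk : ∑ u, ∑ v, w u v using Nat.strong_induction_on generalizing w with
  | _ k ih =>
  have hloop : ∀ v, w v v = 0 := fun v => by
    by_contra h
    exact (hadj v v (Nat.pos_of_ne_zero h)).ne rfl
  obtain ⟨F, hF, hFmax⟩ := exists_max_image ({f | IsMatchingPerm w f} : Finset (Equiv.Perm V))
    (matchingWeight w) ⟨1, by simpa using hid⟩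
  simp only [mem_filter, mem_univ, true_and] at hF hFmax
  -- Lowering the weights by the indicator `δ` of a symmetric set of pairs in the support.
  have lower : ∀ (T : V → V → Prop) [∀ x y, Decidable (T x y)],
      (∀ x y, 0 < w x y → T x y → T y x) →
      ∀ δ : V → V → ℕ, (∀ x y, δ x y = if T x y ∧ 0 < w x y then 1 else 0) →
      ∀ a b, 0 < δ a b → ∃ w' : V → V → ℕ, w = (fun x y => w' x y + δ x y) ∧
        (∀ v, w' v v = 0) ∧
        ∃ f, IsMatchingPerm w f ∧ ∑ u, ∑ v, w' u v ≤ 3 * matchingWeight w' f := by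
    intro T _ hT δ hδ a b hab
    have hle : ∀ x y, δ x y ≤ w x y := by
      intro x y; rw [hδ]; split_ifs with h
      exacts [h.2, Nat.zero_le _]
    have hδsymm : ∀ x y, δ x y = δ y x := by
      intro x y
      rw [hδ, hδ]
      refine if_congr ⟨fun h => ⟨hT _ _ h.2 h.1, hsymm x y ▸ h.2⟩, fun h =>
        ⟨hT _ _ h.2 h.1, hsymm x y ▸ h.2⟩⟩ rfl rfl
    have hmono : ∀ x y, 0 < w x y - δ x y → 0 < w x y := fun x y h => by omega
    refine ⟨fun x y => w x y - δ x y, ?_, fun v => by simp [hloop], ?_⟩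
    · ext x y; exact (Nat.sub_add_cancel (hle x y)).symm
    · have hlt : ∑ u, ∑ v, (w u v - δ u v) < k := by
        rw [← hk]
        refine sum_lt_sum (fun x _ => sum_le_sum fun y _ => Nat.sub_le _ _) ⟨a, mem_univ _, ?_⟩
        refine sum_lt_sum (fun y _ => Nat.sub_le _ _) ⟨b, mem_univ _, ?_⟩
        have := hle a b
        omega
      obtain ⟨f, hf, hfw⟩ := ih _ hlt (fun x y => w x y - δ x y)
        (fun x y => by rw [hsymm x y, hδsymm x y]) (fun x y h => hadj x y (hmono x y h))
        (fun v => ⟨rfl, fun h => absurd rfl h⟩) rfl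
      exact ⟨f, hf.mono hmono, hfw⟩
  suffices h : k ≤ 3 * matchingWeight w F from ⟨F, hF, h⟩
  by_cases hcase : ∃ u, ∀ N, IsMatchingPerm w N →
      (∀ f, IsMatchingPerm w f → matchingWeight w f ≤ matchingWeight w N) → N u ≠ u
  · -- Some vertex `u` is covered by all maximum matchings: lower the weights at `u`.
    obtain ⟨u, hu⟩ := hcase
    let δ : V → V → ℕ := fun x y => if (x = u ∨ y = u) ∧ 0 < w x y then 1 else 0
    have hFu := hu F hF hFmax
    have hpos := (hF u).2 hFu
    obtain ⟨w', hw', -, f, hf, hfw⟩ := lower (fun x y => x = u ∨ y = u) (fun _ _ _ h => h.symm) δ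
      (fun _ _ => rfl) u (F u) (by simp [δ, hpos])
    have htot : ∑ x, ∑ y, w x y = ∑ x, ∑ y, w' x y + ∑ x, ∑ y, δ x y := by
      simp only [hw', sum_add_distrib]
    have hadd : ∀ g, matchingWeight w g = matchingWeight w' g + matchingWeight δ g := fun g => by
      conv_lhs => rw [hw']
      exact matchingWeight_add w' δ g
    have hδ6 : ∑ x, ∑ y, δ x y ≤ 6 := by
      have h1 : ∑ x, ∑ y, δ x y ≤ ∑ x, ∑ y, ((if x = u then (if G.Adj x y then 1 else 0) else 0) +
          (if y = u then (if G.Adj y x then 1 else 0) else 0)) := by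
        refine sum_le_sum fun x _ => sum_le_sum fun y _ => ?_
        simp only [δ]
        split_ifs with h h1 h2 h3 <;> try omega
        all_goals first
          | exact absurd (hadj _ _ h.2) ‹_›
          | exact absurd (hadj _ _ h.2).symm ‹_›
          | exact absurd h.1 (by tauto)
      refine h1.trans_eq ?_
      simp only [sum_add_distrib]
      rw [sum_comm (f := fun x y => if y = u then (if G.Adj y x then 1 else 0) else 0)]
      have h2 : ∑ x, ∑ y, (if x = u then (if G.Adj x y then 1 else 0) else 0) = 3 := by
        rw [sum_eq_single u (fun x _ hx => by simp [hx]) (by simp)]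
        simpa using card_neighbors_of_cubic G hG u
      rw [h2]
    have hδ2 : ∀ g, IsMatchingPerm w g → g u ≠ u → 2 ≤ matchingWeight δ g := by
      intro g hg hgu
      have h1 : ∑ v ∈ {u, g u}, δ v (g v) = 2 := by
        have hp := (hg u).2 hgu
        rw [sum_pair hgu.symm, (hg u).1]
        simp [δ, hp, hsymm (g u) u]
      rw [← h1]
      exact sum_le_sum_of_subset (subset_univ _)
    -- If `f` misses `u`, then `f` is not maximum for `w`; by parity its doubled weight is
    -- smaller by at least two.
    have hgoal : matchingWeight w' f + 2 ≤ matchingWeight w F := by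
      by_cases hfu : f u = u
      · have hlt : matchingWeight w f < matchingWeight w F := by
          by_contra hge
          exact hu f hf (fun g hg => (hFmax g hg).trans (not_lt.1 hge)) hfu
        obtain ⟨i, hi⟩ := even_matchingWeight hsymm hloop (fun v => (hf v).1)
        obtain ⟨j, hj⟩ := even_matchingWeight hsymm hloop (fun v => (hF v).1)
        have := hadd f
        omega
      · have := hFmax f hf
        have := hδ2 f hf hfu
        have := hadd f
        omega
    omega
  · push Not at hcase
    rcases Nat.eq_zero_or_pos k with rfl | hkpos
    · exact Nat.zero_le _
    -- Otherwise lower the weights on a component `C` of the support of `w`.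
    obtain ⟨a, b, hab⟩ : ∃ a b, 0 < w a b := by
      by_contra! h
      have : ∑ u, ∑ v, w u v = 0 :=
        sum_eq_zero fun x _ => sum_eq_zero fun y _ => Nat.le_zero.1 (h x y)
      omega
    let C : Finset V := {x | Relation.ReflTransGen (fun x y => 0 < w x y) a x}
    have hC : ∀ x, x ∈ C ↔ Relation.ReflTransGen (fun x y => 0 < w x y) a x := by simp [C]
    have hCclosed : ∀ x y, 0 < w x y → x ∈ C → y ∈ C := fun x y h hx =>
      (hC y).2 (((hC x).1 hx).tail h)
    have haC : a ∈ C := (hC a).2 .refl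
    let δ : V → V → ℕ := fun x y => if x ∈ C ∧ 0 < w x y then 1 else 0
    obtain ⟨w', hw', hloop', f, hf, hfw⟩ := lower (fun x _ => x ∈ C) hCclosed δ
      (fun _ _ => rfl) a b (by simp [δ, hab, haC])
    have htot : ∑ x, ∑ y, w x y = ∑ x, ∑ y, w' x y + ∑ x, ∑ y, δ x y := by
      simp only [hw', sum_add_distrib]
    have hcov : ∀ g, IsMatchingPerm w g → matchingWeight δ g = #(covered C g) := by
      intro g hg
      rw [matchingWeight, covered, card_filter, ← sum_filter_add_sum_filter_not univ (· ∈ C)]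
      rw [sum_eq_zero (s := filter (fun x => x ∉ C) univ), add_zero]
      · rw [filter_mem_eq_inter, univ_inter]
        refine sum_congr rfl fun x hx => if_congr ⟨fun h hgx => ?_, fun h => ⟨hx, (hg x).2 h⟩⟩
          rfl rfl
        rw [hgx, hloop] at h
        exact h.2.ne rfl
      · intro x hx
        simp only [mem_filter, mem_univ, true_and] at hx
        simp [δ, hx]
    have hadd : ∀ g, IsMatchingPerm w g →
        matchingWeight w g = matchingWeight w' g + #(covered C g) := fun g hg => by
      rw [← hcov g hg]
      conv_lhs => rw [hw']
      exact matchingWeight_add w' δ g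
    obtain ⟨M, hM, hMmax, hMC⟩ := exists_near_perfect hsymm hloop' hC hadd hcase
    have hδ : ∑ x, ∑ y, δ x y ≤ #(G.interedges C C) := by
      rw [SimpleGraph.interedges, Rel.interedges, card_filter, sum_product,
        ← sum_subset (subset_univ C)]
      · refine sum_le_sum fun x hx => ?_
        rw [← sum_subset (subset_univ C)]
        · refine sum_le_sum fun y hy => ?_
          simp only [δ]
          split_ifs with h h'
          exacts [le_rfl, absurd (hadj _ _ h.2) h', Nat.zero_le _, le_rfl]
        · intro y _ hy
          exact if_neg fun h => hy (hCclosed x y h.2 h.1)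
      · intro x _ hx
        exact sum_eq_zero fun y _ => if_neg fun h => hx h.1
    -- `M` covers `C` up to one vertex, and in that case `#C` is odd, so that `C` has at least three
    -- boundary edges.
    have heven : Even #(covered C M) := by
      refine even_card_of_involution _ M (fun x hx => ?_) (fun x _ => (hM x).1) fun x hx => ?_
      · simp only [covered, mem_filter] at hx ⊢
        exact ⟨hCclosed _ _ ((hM x).2 hx.2) hx.1, M.injective.ne hx.2⟩
      · exact (mem_filter.1 hx).2
    have hone : #{x ∈ C | M x = x} ≤ 1 := by
      rw [card_le_one]
      intro x hx y hy
      rw [mem_filter] at hx hy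
      exact hMC x hx.1 y hy.1 hx.2 hy.2
    have hsplit : #{x ∈ C | M x = x} + #(covered C M) = #C :=
      card_filter_add_card_filter_not (s := C) (fun x => M x = x)
    have hdeg := card_interedges_self_add_compl G hG C
    have h3 : #(G.interedges C C) ≤ 3 * #(covered C M) := by
      rcases Nat.le_one_iff_eq_zero_or_eq_one.1 hone with h | h
      · omega
      · have hodd : Odd #C := by
          rw [← hsplit, h, add_comm]
          exact heven.add_one
        have := three_le_card_interedges_compl G hG hb hodd
        omega
    have e1 := hMmax f hf
    have e2 := hadd M hM
    have e3 := hFmax M hM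
    omega

end Induction

/-! ### Real weights and perfect matchings -/

section Crossings

variable {V : Type*} (G : SimpleGraph V)

/-- A perfect matching, encoded as the involution that swaps the ends of each of its edges. -/
def IsPerfectPerm (f : Equiv.Perm V) : Prop := ∀ v, f (f v) = v ∧ G.Adj v (f v)

variable [DecidableEq V]

/-- The number of edges of a perfect matching that leave `W`. -/
def crossing (f : Equiv.Perm V) (W : Finset V) : ℕ := #{v ∈ W | f v ∉ W}

theorem even_card_add_crossing {f : Equiv.Perm V} (hf : IsPerfectPerm G f) (W : Finset V) :
    Even (#W + crossing f W) := by
  have h : Even #{v ∈ W | ¬ f v ∉ W} := by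
    refine even_card_of_involution _ f (fun v hv => ?_) (fun v _ => (hf v).1)
      fun v _ => (hf v).2.ne.symm
    simp only [mem_filter, not_not] at hv ⊢
    exact ⟨hv.2, by rw [(hf v).1]; exact hv.1⟩
  have h2 := card_filter_add_card_filter_not (s := W) (fun v => f v ∉ W)
  obtain ⟨k, hk⟩ := h
  exact ⟨k + crossing f W, by simp only [crossing]; omega⟩

/-- The indicator of the pairs separated by `W`. -/
def separates (W : Finset V) (u v : V) : ℝ :=
  (if u ∈ W ∧ v ∉ W then 1 else 0) + (if v ∈ W ∧ u ∉ W then 1 else 0)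

theorem separates_comm (W : Finset V) (u v : V) : separates W u v = separates W v u :=
  add_comm _ _

theorem separates_nonneg (W : Finset V) (u v : V) : 0 ≤ separates W u v := by
  unfold separates; positivity

end Crossings

section RealWeights

variable {V : Type*} [Fintype V] [DecidableEq V] (G : SimpleGraph V) [DecidableRel G.Adj]

theorem exists_matching_real_weight_ge (hG : G.IsRegularOfDegree 3) (hb : IsBridgeless G)
    (w : V → V → ℝ) (hsymm : ∀ u v, w u v = w v u) (hpos : ∀ u v, 0 ≤ w u v)
    (hadj : ∀ u v, ¬ G.Adj u v → w u v = 0) :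
    ∃ f : Equiv.Perm V, (∀ v, f (f v) = v ∧ (f v ≠ v → G.Adj v (f v))) ∧
      ∑ u, ∑ v, w u v ≤ 3 * ∑ v, w v (f v) := by
  classical
  obtain ⟨F, hF, hFmax⟩ := exists_max_image
    ({f | ∀ v, f (f v) = v ∧ (f v ≠ v → G.Adj v (f v))} : Finset (Equiv.Perm V))
    (fun f => ∑ v, w v (f v)) ⟨1, by simp⟩
  simp only [mem_filter, mem_univ, true_and] at hF hFmax
  refine ⟨F, hF, le_of_forall_pos_le_add fun ε hε => ?_⟩
  -- Rounding `N • w` down loses at most one per pair.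
  obtain ⟨N, hN⟩ := exists_nat_gt ((Fintype.card V : ℝ) * Fintype.card V / ε)
  have hNpos : (0 : ℝ) < N := lt_of_le_of_lt (by positivity) hN
  have hpos' : ∀ u v, 0 < ⌊N * w u v⌋₊ → G.Adj u v := by
    intro u v h
    by_contra h'
    rw [hadj u v h', mul_zero, Nat.floor_zero] at h
    exact h.ne rfl
  obtain ⟨f, hf, hfw⟩ := exists_matching_weight_ge G hG hb (fun u v => ⌊N * w u v⌋₊)
    (fun u v => by rw [hsymm]) hpos'
  have hfF := hFmax f fun v => ⟨(hf v).1, fun h => hpos' _ _ ((hf v).2 h)⟩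
  have h1 : ∑ u, ∑ v, (N * w u v - 1) ≤ ∑ u, ∑ v, (⌊N * w u v⌋₊ : ℝ) :=
    sum_le_sum fun u _ => sum_le_sum fun v _ => (Nat.sub_one_lt_floor _).le
  have h2 : (matchingWeight (fun u v => ⌊N * w u v⌋₊) f : ℝ) ≤ N * ∑ v, w v (f v) := by
    rw [matchingWeight, Nat.cast_sum, mul_sum]
    exact sum_le_sum fun v _ => Nat.floor_le (mul_nonneg hNpos.le (hpos _ _))
  have h3 : ∑ u, ∑ v, (⌊N * w u v⌋₊ : ℝ) ≤
      3 * (matchingWeight (fun u v => ⌊N * w u v⌋₊) f : ℝ) := by exact_mod_cast hfw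
  simp only [sum_sub_distrib, ← mul_sum, sum_const, card_univ, nsmul_eq_mul, mul_one] at h1
  rw [div_lt_iff₀ hε] at hN
  have h4 : (N : ℝ) * ∑ v, w v (f v) ≤ N * ∑ v, w v (F v) :=
    mul_le_mul_of_nonneg_left hfF hNpos.le
  have h5 : (N : ℝ) * ∑ u, ∑ v, w u v ≤ N * (3 * ∑ v, w v (F v) + ε) := by linarith
  exact le_of_mul_le_mul_left h5 hNpos

theorem even_cut_add_crossing (hG : G.IsRegularOfDegree 3) {f : Equiv.Perm V}
    (hf : IsPerfectPerm G f) (W : Finset V) : Even (#(G.interedges W Wᶜ) + crossing f W) := by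
  obtain ⟨k, hk⟩ := even_card_add_crossing G hf W
  obtain ⟨l, hl⟩ := even_card_interedges_self G W
  have := card_interedges_self_add_compl G hG W
  rw [Nat.even_iff]
  omega

theorem separates_le_cut {W : Finset V} {u v : V} (h : G.Adj u v) :
    separates W u v ≤ #(G.interedges W Wᶜ) := by
  have key : ∀ {x y}, G.Adj x y → x ∈ W → y ∉ W → (1 : ℝ) ≤ #(G.interedges W Wᶜ) := by
    intro x y hxy hx hy
    have : (x, y) ∈ G.interedges W Wᶜ := by
      rw [SimpleGraph.mem_interedges_iff]; exact ⟨hx, mem_compl.2 hy, hxy⟩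
    exact_mod_cast card_pos.2 ⟨_, this⟩
  unfold separates
  by_cases hu : u ∈ W <;> by_cases hv : v ∈ W <;> simp only [hu, hv, not_true_eq_false,
    not_false_eq_true, and_true, and_false, if_true, if_false, add_zero, zero_add]
  · positivity
  · exact key h hu hv
  · exact key h.symm hv hu
  · positivity

theorem sum_separates_adj (W : Finset V) :
    ∑ u, ∑ v, (if G.Adj u v then separates W u v else 0) = 2 * #(G.interedges W Wᶜ) := by
  have h : ∑ u, ∑ v, (if G.Adj u v then (if u ∈ W ∧ v ∉ W then (1 : ℝ) else 0) else 0) =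
      #(G.interedges W Wᶜ) := by
    rw [← univ.sum_product' univ (fun u v => if G.Adj u v then
      (if u ∈ W ∧ v ∉ W then (1 : ℝ) else 0) else 0)]
    simp only [← ite_and, sum_boole, univ_product_univ]
    congr 2
    ext x
    simp only [mem_filter, mem_univ, true_and, SimpleGraph.mem_interedges_iff, mem_compl]
    tauto
  have h' : ∀ u v, (if G.Adj u v then separates W u v else 0) =
      (if G.Adj u v then (if u ∈ W ∧ v ∉ W then (1 : ℝ) else 0) else 0) +
      (if G.Adj v u then (if v ∈ W ∧ u ∉ W then (1 : ℝ) else 0) else 0) := by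
    intro u v
    simp only [separates, G.adj_comm v u]
    split_ifs <;> simp
  simp only [h', sum_add_distrib]
  rw [h, sum_comm, h, two_mul]

theorem sum_separates_matching {f : Equiv.Perm V} (hf : ∀ v, f (f v) = v) (W : Finset V) :
    ∑ v, separates W v (f v) = 2 * crossing f W := by
  have h : ∑ v, (if v ∈ W ∧ f v ∉ W then (1 : ℝ) else 0) = crossing f W := by
    rw [sum_boole, crossing]
    congr 2
    ext v; simp
  simp only [separates, sum_add_distrib]
  rw [h, ← Equiv.sum_comp f (fun v => if f v ∈ W ∧ v ∉ W then (1 : ℝ) else 0)]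
  simp only [hf]
  rw [h, two_mul]

/-- The point with all coordinates `1/3` lies in the perfect matching polytope, in its dual form:
some perfect matching has at most a third of the total weight, here for weights that are
combinations of cuts. -/
theorem exists_perfect_crossing_le (hG : G.IsRegularOfDegree 3) (hb : IsBridgeless G)
    (κ : Finset V → ℝ) (hκ : ∀ W, 0 ≤ κ W) :
    ∃ f : Equiv.Perm V, IsPerfectPerm G f ∧
      3 * ∑ W, κ W * crossing f W ≤ ∑ W, κ W * #(G.interedges W Wᶜ) := by
  set B := ∑ W, κ W * #(G.interedges W Wᶜ) with hB
  have hBpos : 0 ≤ B := sum_nonneg fun W _ => mul_nonneg (hκ W) (Nat.cast_nonneg _)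
  let σ : V → V → ℝ := fun u v => ∑ W, κ W * separates W u v
  have hσpos : ∀ u v, 0 ≤ σ u v := fun u v =>
    sum_nonneg fun W _ => mul_nonneg (hκ W) (separates_nonneg W u v)
  have hσle : ∀ u v, G.Adj u v → σ u v ≤ B := fun u v h =>
    sum_le_sum fun W _ => mul_le_mul_of_nonneg_left (separates_le_cut G h) (hκ W)
  -- The constant `B + 1` is so large that matchings of large weight must be perfect.
  obtain ⟨f, hf, hfw⟩ := exists_matching_real_weight_ge G hG hb
    (fun u v => if G.Adj u v then (B + 1) - σ u v else 0)
    (fun u v => by simp only [G.adj_comm u v, σ, separates_comm _ u v])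
    (fun u v => by
      split_ifs with h
      · linarith [hσle u v h]
      · exact le_rfl)
    (fun u v h => if_neg h)
  have htot : ∑ u, ∑ v, (if G.Adj u v then (B + 1) - σ u v else 0) =
      3 * (B + 1) * Fintype.card V - 2 * B := by
    have h1 : ∀ u v, (if G.Adj u v then (B + 1) - σ u v else 0) =
        (if G.Adj u v then (B + 1) else 0) -
          ∑ W, κ W * (if G.Adj u v then separates W u v else 0) := by
      intro u v
      split_ifs <;> simp [σ]
    have h2 : ∑ u, ∑ v, ∑ W, κ W * (if G.Adj u v then separates W u v else 0) = 2 * B := by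
      simp only [sum_comm (s := univ) (t := (univ : Finset (Finset V)))]
      rw [hB, mul_sum]
      refine sum_congr rfl fun W _ => ?_
      simp only [← mul_sum]
      rw [sum_separates_adj]
      ring
    have h3 : ∀ u, ∑ v, (if G.Adj u v then (B + 1) else 0) = 3 * (B + 1) := by
      intro u
      rw [← sum_filter, sum_const, card_neighbors_of_cubic G hG, nsmul_eq_mul]
      norm_num
    simp only [h1, sum_sub_distrib, h2, h3, sum_const, card_univ, nsmul_eq_mul]
    ring
  rw [htot] at hfw
  have hperf : ∀ v, f v ≠ v := by
    intro v₀ hv₀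
    have h1 : ∑ v, (if G.Adj v (f v) then (B + 1) - σ v (f v) else 0) ≤
        ∑ v, (if v = v₀ then 0 else (B + 1)) := by
      refine sum_le_sum fun v _ => ?_
      by_cases hv : v = v₀
      · subst hv; simp [hv₀]
      · rw [if_neg hv]
        split_ifs
        · linarith [hσpos v (f v)]
        · linarith
    have h2 : ∑ v, (if v = v₀ then 0 else (B + 1)) = (B + 1) * Fintype.card V - (B + 1) := by
      rw [← add_sum_erase _ _ (mem_univ v₀), if_pos rfl, zero_add,
        sum_congr rfl fun v hv => if_neg (ne_of_mem_erase hv), sum_const,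
        card_erase_of_mem (mem_univ _), nsmul_eq_mul, card_univ,
        Nat.cast_sub (Fintype.card_pos_iff.2 ⟨v₀⟩)]
      push_cast
      ring
    rw [h2] at h1
    linarith
  have hfp : IsPerfectPerm G f := fun v => ⟨(hf v).1, (hf v).2 (hperf v)⟩
  refine ⟨f, hfp, ?_⟩
  have h1 : ∑ v, (if G.Adj v (f v) then (B + 1) - σ v (f v) else 0) =
      (B + 1) * Fintype.card V - 2 * ∑ W, κ W * crossing f W := by
    rw [sum_congr rfl fun v _ => if_pos (hfp v).2, sum_sub_distrib, sum_const, card_univ,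
      nsmul_eq_mul, sum_comm, mul_sum, mul_comm]
    congr 1
    refine sum_congr rfl fun W _ => ?_
    rw [← mul_sum, sum_separates_matching fun v => (hf v).1]
    ring
  rw [h1] at hfw
  linarith

/-- The perfect matching can moreover be chosen to meet every 3-edge-cut exactly once: by parity
it meets each of them at least once, so a large extra weight on these cuts forces equality. -/
theorem exists_perfect_crossing_le_of_three_cut (hG : G.IsRegularOfDegree 3)
    (hb : IsBridgeless G) (κ : Finset V → ℝ) (hκ : ∀ W, 0 ≤ κ W) :
    ∃ f : Equiv.Perm V, IsPerfectPerm G f ∧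
      (∀ W, #(G.interedges W Wᶜ) = 3 → crossing f W = 1) ∧
      3 * ∑ W, κ W * crossing f W ≤ ∑ W, κ W * #(G.interedges W Wᶜ) := by
  set B := ∑ W, κ W * #(G.interedges W Wᶜ) with hB
  have hBpos : 0 ≤ B := sum_nonneg fun W _ => mul_nonneg (hκ W) (Nat.cast_nonneg _)
  obtain ⟨K, hK⟩ : ∃ K, K = B + 1 := ⟨_, rfl⟩
  have hKpos : 0 ≤ K := by linarith
  obtain ⟨f, hf, hle⟩ := exists_perfect_crossing_le G hG hb
    (fun W => κ W + if #(G.interedges W Wᶜ) = 3 then K else 0)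
    (fun W => add_nonneg (hκ W) (by split_ifs; exacts [hKpos, le_rfl]))
  set T : Finset (Finset V) := {W | #(G.interedges W Wᶜ) = 3} with hT
  simp only [add_mul, sum_add_distrib, ite_mul, zero_mul, ← hB] at hle
  rw [← sum_filter, ← sum_filter, ← hT, ← mul_sum, ← mul_sum] at hle
  have hcut : ∑ W ∈ T, (#(G.interedges W Wᶜ) : ℝ) = ∑ W ∈ T, 3 :=
    sum_congr rfl fun W hW => by rw [(mem_filter.1 hW).2]; norm_num
  have hone : ∀ W ∈ T, 1 ≤ crossing f W := by
    intro W hW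
    obtain ⟨k, hk⟩ := even_cut_add_crossing G hG hf W
    have := (mem_filter.1 hW).2
    omega
  have hκf : 0 ≤ ∑ W, κ W * (crossing f W : ℝ) :=
    sum_nonneg fun W _ => mul_nonneg (hκ W) (Nat.cast_nonneg _)
  have hmain : 3 * ∑ W, κ W * (crossing f W : ℝ) +
      3 * (K * ∑ W ∈ T, ((crossing f W : ℝ) - 1)) ≤ B := by
    have : ∑ W ∈ T, (3 : ℝ) = 3 * ∑ W ∈ T, 1 := by rw [mul_sum]; simp
    rw [hcut, this] at hle
    rw [sum_sub_distrib]
    linarith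
  have hexcess : ∀ W ∈ T, (0 : ℝ) ≤ crossing f W - 1 := fun W hW => by
    have : (1 : ℝ) ≤ crossing f W := by exact_mod_cast hone W hW
    linarith
  refine ⟨f, hf, fun W hW => ?_, ?_⟩
  · by_contra hne
    have hWT : W ∈ T := by simp [hT, hW]
    have h2 : (2 : ℝ) ≤ crossing f W := by
      have := hone W hWT
      exact_mod_cast (by omega : 2 ≤ crossing f W)
    have h3 : (1 : ℝ) ≤ ∑ W ∈ T, ((crossing f W : ℝ) - 1) :=
      le_trans (by linarith) (single_le_sum hexcess hWT)
    nlinarith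
  · have := mul_nonneg hKpos (sum_nonneg hexcess)
    linarith

end RealWeights

/-! ### Two-factors and averaging -/

section TwoFactors

variable {V : Type*} (G : SimpleGraph V)

/-- The complement of a perfect matching. -/
def complementSubgraph {f : Equiv.Perm V} (hf : IsPerfectPerm G f) : G.Subgraph where
  verts := Set.univ
  Adj u v := G.Adj u v ∧ f u ≠ v
  adj_sub h := h.1
  edge_vert _ := Set.mem_univ _
  symm := ⟨fun u v h => ⟨h.1.symm, fun h' => h.2 (by rw [← h', (hf v).1])⟩⟩

variable [Fintype V] [DecidableRel G.Adj]

theorem isTwoFactor_complementSubgraph [DecidableEq V] (hG : G.IsRegularOfDegree 3)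
    {f : Equiv.Perm V} (hf : IsPerfectPerm G f) : IsTwoFactor (complementSubgraph G hf) := by
  refine ⟨fun v => Set.mem_univ v, fun u => ?_⟩
  have h : (complementSubgraph G hf).neighborSet u =
      (({v | G.Adj u v} : Finset V).erase (f u) : Finset V) := by
    ext v
    simp [complementSubgraph, eq_comm]
  rw [h, Set.ncard_coe_finset, card_erase_of_mem (by simpa using (hf u).2),
    card_neighbors_of_cubic G hG]

variable [DecidableEq V]

theorem injOn_interedges (W : Finset V) :
    Set.InjOn (fun x : V × V => s(x.1, x.2)) (G.interedges W Wᶜ : Finset (V × V)) := by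
  rintro ⟨a, b⟩ hx ⟨c, d⟩ hy hxy
  simp only [mem_coe, SimpleGraph.mem_interedges_iff, mem_compl] at hx hy
  rcases Sym2.eq_iff.1 hxy with ⟨rfl, rfl⟩ | ⟨rfl, rfl⟩
  · rfl
  · exact absurd hx.1 hy.2.1

theorem ncard_boundary (W : Finset V) : (boundary G (W : Set V)).ncard = #(G.interedges W Wᶜ) := by
  have h : boundary G (W : Set V) =
      (fun x : V × V => s(x.1, x.2)) '' (G.interedges W Wᶜ : Finset (V × V)) := by
    ext e
    simp only [boundary, Set.mem_ofPred_eq, Set.mem_image, mem_coe, Prod.exists,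
      SimpleGraph.mem_interedges_iff, mem_compl]
    exact ⟨fun ⟨u, v, h1, h2, h3, h4⟩ => ⟨u, v, ⟨h1, h2, h3⟩, h4.symm⟩,
      fun ⟨u, v, ⟨h1, h2, h3⟩, h4⟩ => ⟨u, v, h1, h2, h3, h4.symm⟩⟩
  rw [h, (injOn_interedges G W).ncard_image, Set.ncard_coe_finset]

theorem ncard_boundary_inter_add_crossing {f : Equiv.Perm V} (hf : IsPerfectPerm G f)
    (W : Finset V) :
    (boundary G (W : Set V) ∩ (complementSubgraph G hf).edgeSet).ncard + crossing f W =
      #(G.interedges W Wᶜ) := by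
  have h : boundary G (W : Set V) ∩ (complementSubgraph G hf).edgeSet =
      (fun x : V × V => s(x.1, x.2)) '' ({x ∈ G.interedges W Wᶜ | ¬ f x.1 = x.2} :
        Finset (V × V)) := by
    ext e
    simp only [boundary, Set.mem_inter_iff, Set.mem_ofPred_eq, Set.mem_image, mem_coe, Prod.exists,
      SimpleGraph.mem_interedges_iff, mem_compl, mem_filter]
    constructor
    · rintro ⟨⟨u, v, h1, h2, h3, rfl⟩, h5⟩
      exact ⟨u, v, ⟨⟨h1, h2, h3⟩, h5.2⟩, rfl⟩
    · rintro ⟨u, v, ⟨⟨h1, h2, h3⟩, h5⟩, rfl⟩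
      exact ⟨⟨u, v, h1, h2, h3, rfl⟩, h3, h5⟩
  have hc : crossing f W = #{x ∈ G.interedges W Wᶜ | f x.1 = x.2} := by
    refine card_bij (fun v _ => (v, f v)) (fun v hv => ?_) (fun v _ v' _ h => congrArg Prod.fst h)
      fun x hx => ?_
    · rw [mem_filter] at hv
      rw [mem_filter, SimpleGraph.mem_interedges_iff]
      exact ⟨⟨hv.1, mem_compl.2 hv.2, (hf v).2⟩, rfl⟩
    · rw [mem_filter, SimpleGraph.mem_interedges_iff, mem_compl] at hx
      exact ⟨x.1, mem_filter.2 ⟨hx.1.1, hx.2 ▸ hx.1.2.1⟩, Prod.ext rfl hx.2⟩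
  rw [h, ((injOn_interedges G W).mono (by
    exact_mod_cast filter_subset _ _)).ncard_image, Set.ncard_coe_finset, hc, add_comm,
    card_filter_add_card_filter_not]

end TwoFactors

section Averaging

/-- What the condition on `r` says when `r < s`: the gain on members avoided by the 2-factor is
outweighed by the loss on members traversed as often as possible. -/
theorem bound_of_ratio {b n : ℕ} (hb : b ∈ ({2, 4, 5, 6, 7, 9} : Set ℕ)) {r s t p : ℝ}
    (hp : 0 ≤ p) (hrs : r < s)
    (hr : r ≥ ((1.5 * (evenFloor b : ℝ) - (b : ℝ)) * s + p / (n : ℝ) * (b : ℝ) * t)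
          / ((1.5 * (evenFloor b : ℝ) - (b : ℝ)) + p / (n : ℝ) * (b : ℝ))) :
    (n : ℝ) * (s - r) * (1.5 * (evenFloor b : ℝ) - b) ≤ b * p * (r - t) ∧ 0 ≤ r - t := by
  have hα : (0 : ℝ) < 1.5 * (evenFloor b : ℝ) - b := by
    have : 2 * b < 3 * evenFloor b := by
      simp only [Set.mem_insert_iff, Set.mem_singleton_iff] at hb
      unfold evenFloor
      omega
    have : (2 * b : ℝ) < 3 * evenFloor b := by exact_mod_cast this
    linarith
  set α := 1.5 * (evenFloor b : ℝ) - (b : ℝ)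
  have hq : 0 ≤ p / n * b := by positivity
  rw [ge_iff_le, div_le_iff₀ (by linarith)] at hr
  have h1 : α * (s - r) ≤ p / n * b * (r - t) := by linarith
  have h2 : 0 < α * (s - r) := mul_pos hα (by linarith)
  have h3 : 0 < r - t := pos_of_mul_pos_right (h2.trans_le h1) hq
  -- For `n = 0` the quotient `p / n` is `0`, which contradicts `r < s`.
  have hn : (n : ℝ) ≠ 0 := by
    intro h
    rw [h, div_zero, zero_mul, zero_mul] at h1
    linarith
  refine ⟨?_, h3.le⟩
  have h4 := mul_le_mul_of_nonneg_left h1 (Nat.cast_nonneg (α := ℝ) n)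
  have h5 : (n : ℝ) * (p / n * b * (r - t)) = b * p * (r - t) := by field_simp
  linarith

/-- The contribution of a member is bounded by a linear function of the number `x` of its boundary
edges in the 2-factor.  This is where the values of `b` matter: an even `x < 2 ⌊b / 2⌋` does not
exceed the average `2b / 3`. -/
theorem contribution_le {b n x : ℕ} (hb : b ∈ ({2, 4, 5, 6, 7, 9} : Set ℕ)) (hx : Even x)
    (hxb : x ≤ b) {r s t p : ℝ} (hrs : r < s)
    (h : (n : ℝ) * (s - r) * (1.5 * (evenFloor b : ℝ) - b) ≤ b * p * (r - t)) :
    n * (if x = 0 then s - r else 0) - p * (if x = evenFloor b then r - t else 0) ≤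
      n * (s - r) / b * (b - 1.5 * x) := by
  have hcases : x = 0 ∨ x = evenFloor b ∨ 3 * x ≤ 2 * b := by
    obtain ⟨k, rfl⟩ := hx
    simp only [Set.mem_insert_iff, Set.mem_singleton_iff] at hb
    unfold evenFloor
    omega
  have hapos : 0 < evenFloor b := by
    simp only [Set.mem_insert_iff, Set.mem_singleton_iff] at hb
    unfold evenFloor
    omega
  have hbpos : (0 : ℝ) < b := by
    have : 0 < b := by unfold evenFloor at hapos; omega
    exact_mod_cast this
  by_cases h0 : x = 0
  · subst h0
    rw [if_pos rfl, if_neg hapos.ne]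
    apply le_of_eq
    field_simp
    simp
  by_cases ha : x = evenFloor b
  · rw [if_neg h0, if_pos ha, ha, mul_zero, zero_sub, div_mul_eq_mul_div, le_div_iff₀ hbpos]
    linarith
  · rw [if_neg h0, if_neg ha, mul_zero, mul_zero, sub_zero]
    have h3 : (3 * x : ℝ) ≤ 2 * b := by exact_mod_cast (hcases.resolve_left h0).resolve_left ha
    have : 0 ≤ s - r := by linarith
    exact mul_nonneg (by positivity) (by linarith)

variable {V : Type*} [Fintype V] {G : SimpleGraph V}

theorem ncard_vertexUnion_le {𝓗 : Set G.Subgraph} {n : ℕ} (h : ∀ H ∈ 𝓗, H.verts.ncard = n) :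
    (vertexUnion 𝓗).ncard ≤ n * 𝓗.ncard := by
  classical
  have hfin : 𝓗.Finite := Set.toFinite _
  have hU : vertexUnion 𝓗 = (hfin.toFinset.biUnion fun H => H.verts.toFinset : Finset V) := by
    ext v; simp [vertexUnion]
  rw [hU, Set.ncard_coe_finset, Set.ncard_eq_toFinset_card _ hfin, mul_comm]
  refine card_biUnion_le_card_mul _ _ _ fun H hH => ?_
  rw [← Set.ncard_eq_toFinset_card']
  exact (h H (hfin.mem_toFinset.1 hH)).le

/-- Summing the bounds on `c` over all vertices; only the collections with `r < s` can push the
sum above `r * |V|`. -/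
theorem sum_sub_le {ι : Type*} {c : V → ℝ} {r : ℝ} (I : Set ι) (J : Finset ι)
    {s t : ι → ℝ} (hJ : ∀ i, i ∈ J ↔ i ∈ I ∧ r < s i) (U S : ι → Set V)
    (hU : ∀ i ∈ I, ∀ v ∈ U i, c v ≤ s i) (hout : ∀ v, (∀ i ∈ I, v ∉ U i) → c v ≤ r)
    (hS : ∀ i ∈ I, ∀ v ∈ S i, c v ≤ t i)
    (hdisj : ∀ i ∈ I, ∀ j ∈ I, i ≠ j → Disjoint (S i) (S j)) :
    ∑ v, (c v - r) ≤ ∑ i ∈ J, ((U i).ncard * (s i - r) - (S i).ncard * (r - t i)) := by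
  classical
  have hcount : ∀ (A : Set V) (y : ℝ), (A.ncard : ℝ) * y = ∑ v, if v ∈ A then y else 0 := by
    intro A y
    rw [← sum_filter, sum_const, nsmul_eq_mul, ← Set.ncard_coe_finset]
    simp
  simp only [hcount, ← sum_sub_distrib]
  rw [sum_comm]
  refine sum_le_sum fun v _ => ?_
  rw [sum_sub_distrib]
  have hnonneg : ∀ i ∈ J, 0 ≤ if v ∈ U i then s i - r else 0 := fun i hi => by
    split_ifs
    · linarith [((hJ i).1 hi).2]
    · exact le_rfl
  by_cases hv : ∃ i ∈ J, v ∈ S i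
  · obtain ⟨i, hi, hvi⟩ := hv
    have hiI := ((hJ i).1 hi).1
    rw [sum_eq_single_of_mem (f := fun i => if v ∈ S i then r - t i else 0) i hi
      fun j hj hji => if_neg fun hvj => ?_, if_pos hvi]
    · linarith [hS i hiI v hvi, sum_nonneg hnonneg]
    · exact Set.disjoint_left.1 (hdisj j ((hJ j).1 hj).1 i hiI hji) hvj hvi
  · push Not at hv
    rw [sum_eq_zero (f := fun i => if v ∈ S i then r - t i else 0) fun i hi => if_neg (hv i hi),
      sub_zero]
    by_cases hvU : ∃ i ∈ J, v ∈ U i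
    · obtain ⟨i, hi, hvi⟩ := hvU
      have h1 := single_le_sum hnonneg hi
      rw [if_pos hvi] at h1
      linarith [hU i ((hJ i).1 hi).1 v hvi]
    · push Not at hvU
      have hcr : c v ≤ r := by
        by_cases h : ∃ i ∈ I, v ∈ U i
        · obtain ⟨i, hi, hvi⟩ := h
          refine (hU i hi v hvi).trans (not_lt.1 fun hlt => hvU i ((hJ i).2 ⟨hi, hlt⟩) hvi)
        · push Not at h
          exact hout v h
      linarith [sum_nonneg hnonneg]

end Averaging

end CubicTSP

theorem mainTheorem3 {V : Type*} [Fintype V] (G : SimpleGraph V) [DecidableRel G.Adj]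
    (hcubic : G.IsRegularOfDegree 3) (hbridgeless : CubicTSP.IsBridgeless G)
    (r : ℝ)
    (I : Set (Set G.Subgraph)) (n b : Set G.Subgraph → ℕ)
    (hgood : ∀ 𝓗 ∈ I, CubicTSP.IsGoodCollection G 𝓗 (n 𝓗) (b 𝓗))
    (p s t : Set G.Subgraph → ℝ)
    (hp : ∀ 𝓗 ∈ I, 0 ≤ p 𝓗)
    (hr : ∀ 𝓗 ∈ I,
      r ≥ ((1.5 * (CubicTSP.evenFloor (b 𝓗) : ℝ) - (b 𝓗 : ℝ)) * s 𝓗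
            + p 𝓗 / (n 𝓗 : ℝ) * (b 𝓗 : ℝ) * t 𝓗)
          / ((1.5 * (CubicTSP.evenFloor (b 𝓗) : ℝ) - (b 𝓗 : ℝ))
            + p 𝓗 / (n 𝓗 : ℝ) * (b 𝓗 : ℝ))) :
    ∃ F : G.Subgraph, CubicTSP.IsTwoFactor F ∧
      (∀ X : Set (Sym2 V), CubicTSP.IsEdgeCut G 3 X → ∃ e ∈ X, e ∈ F.edgeSet) ∧
      ∀ c : V → ℝ,
        (∀ 𝓗 ∈ I, ∀ v ∈ CubicTSP.vertexUnion (CubicTSP.withBoundaryIn F 𝓗 0), c v ≤ s 𝓗) →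
        (∀ v : V, (∀ 𝓗 ∈ I, v ∉ CubicTSP.vertexUnion (CubicTSP.withBoundaryIn F 𝓗 0)) →
          c v ≤ r) →
        (∃ S : Set G.Subgraph → Set V,
          (∀ 𝓗 ∈ I,
            ((S 𝓗).ncard : ℝ) ≥
              p 𝓗 * ((CubicTSP.withBoundaryIn F 𝓗 (CubicTSP.evenFloor (b 𝓗))).ncard : ℝ) ∧
            ∀ v ∈ S 𝓗, c v ≤ t 𝓗) ∧
          ∀ 𝓗 ∈ I, ∀ 𝓚 ∈ I, 𝓗 ≠ 𝓚 → Disjoint (S 𝓗) (S 𝓚)) →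
        ∑ v : V, c v ≤ r * (Fintype.card V : ℝ) := by
  classical
  have : Fintype (Set G.Subgraph) := Fintype.ofFinite _
  have : Fintype G.Subgraph := Fintype.ofFinite _
  let J : Finset (Set G.Subgraph) := {𝓗 | 𝓗 ∈ I ∧ r < s 𝓗}
  have hJ : ∀ 𝓗, 𝓗 ∈ J ↔ 𝓗 ∈ I ∧ r < s 𝓗 := fun 𝓗 => by simp [J]
  let vs : G.Subgraph → Finset V := fun H => H.verts.toFinset
  have hvs : ∀ H, ((vs H : Finset V) : Set V) = H.verts := fun H => Set.coe_toFinset _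
  let co : Set G.Subgraph → ℝ := fun 𝓗 => n 𝓗 * (s 𝓗 - r) / b 𝓗
  have hco : ∀ 𝓗 ∈ J, 0 ≤ co 𝓗 := fun 𝓗 h =>
    div_nonneg (mul_nonneg (Nat.cast_nonneg _) (by linarith [((hJ 𝓗).1 h).2])) (Nat.cast_nonneg _)
  -- The total weight of a cut: `co 𝓗`, the slope in `contribution_le`, for every member of a
  -- collection `𝓗` that has this vertex set.
  let κ : Finset V → ℝ := fun W => ∑ 𝓗 ∈ J, ∑ H with H ∈ 𝓗, if vs H = W then co 𝓗 else 0
  have hκsum : ∀ g : Finset V → ℝ,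
      ∑ W, κ W * g W = ∑ 𝓗 ∈ J, ∑ H with H ∈ 𝓗, co 𝓗 * g (vs H) := by
    intro g
    simp only [κ, sum_mul, ite_mul, zero_mul]
    rw [sum_comm]
    refine sum_congr rfl fun 𝓗 _ => ?_
    rw [sum_comm]
    refine sum_congr rfl fun H _ => ?_
    rw [sum_ite_eq, if_pos (mem_univ _)]
  obtain ⟨f, hf, hcut, hle⟩ := CubicTSP.exists_perfect_crossing_le_of_three_cut G hcubic
    hbridgeless κ fun W => sum_nonneg fun 𝓗 h𝓗 => sum_nonneg fun H _ => by
      split_ifs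
      exacts [hco 𝓗 h𝓗, le_rfl]
  rw [hκsum, hκsum] at hle
  set F := CubicTSP.complementSubgraph G hf with hF
  refine ⟨F, CubicTSP.isTwoFactor_complementSubgraph G hcubic hf, ?_, ?_⟩
  · rintro _ ⟨⟨W, rfl⟩, hX⟩
    obtain ⟨W, rfl⟩ : ∃ W' : Finset V, (W' : Set V) = W := ⟨W.toFinset, Set.coe_toFinset _⟩
    rw [CubicTSP.ncard_boundary] at hX
    have h1 := CubicTSP.ncard_boundary_inter_add_crossing G hf W
    rw [hcut W hX, hX] at h1
    obtain ⟨e, he⟩ := Set.nonempty_of_ncard_ne_zero (by omega : (CubicTSP.boundary G (W : Set V) ∩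
      (CubicTSP.complementSubgraph G hf).edgeSet).ncard ≠ 0)
    exact ⟨e, he.1, he.2⟩
  · rintro c hc0 hcr ⟨S, hS, hdisj⟩
    let x : G.Subgraph → ℕ := fun H => (CubicTSP.boundary G H.verts ∩ F.edgeSet).ncard
    have hx : ∀ H, x H + CubicTSP.crossing f (vs H) = (CubicTSP.boundary G H.verts).ncard := by
      intro H
      have h1 := CubicTSP.ncard_boundary_inter_add_crossing G hf (vs H)
      rw [← CubicTSP.ncard_boundary, hvs] at h1
      exact h1
    have hxeven : ∀ H, Even (x H) := by
      intro H
      have h1 := hx H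
      have h2 := CubicTSP.even_cut_add_crossing G hcubic hf (vs H)
      rw [← CubicTSP.ncard_boundary, hvs, ← h1] at h2
      rw [Nat.even_iff] at h2 ⊢
      omega
    have hwith : ∀ 𝓗 k, ((CubicTSP.withBoundaryIn F 𝓗 k).ncard : ℝ) =
        ∑ H with H ∈ 𝓗, if x H = k then 1 else 0 := by
      intro 𝓗 k
      rw [sum_boole, filter_filter, ← Set.ncard_coe_finset]
      congr 2
      ext H
      simp [CubicTSP.withBoundaryIn, x]
    have hmain := CubicTSP.sum_sub_le I J hJ
      (fun 𝓗 => CubicTSP.vertexUnion (CubicTSP.withBoundaryIn F 𝓗 0)) S hc0 hcr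
      (fun 𝓗 h => (hS 𝓗 h).2) hdisj
    have hcoll : ∀ 𝓗 ∈ J, ((CubicTSP.vertexUnion (CubicTSP.withBoundaryIn F 𝓗 0)).ncard : ℝ) *
        (s 𝓗 - r) - (S 𝓗).ncard * (r - t 𝓗) ≤
          ∑ H with H ∈ 𝓗, co 𝓗 * (b 𝓗 - 1.5 * x H) := by
      intro 𝓗 h𝓗
      obtain ⟨hI, hrs⟩ := (hJ 𝓗).1 h𝓗
      obtain ⟨hb, hmem⟩ := hgood 𝓗 hI
      obtain ⟨hbd, hrt⟩ := CubicTSP.bound_of_ratio hb (hp 𝓗 hI) hrs (hr 𝓗 hI)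
      have h1 : ((CubicTSP.vertexUnion (CubicTSP.withBoundaryIn F 𝓗 0)).ncard : ℝ) ≤
          n 𝓗 * (CubicTSP.withBoundaryIn F 𝓗 0).ncard := by
        exact_mod_cast CubicTSP.ncard_vertexUnion_le
            fun H (hH : H ∈ CubicTSP.withBoundaryIn F 𝓗 0) => (hmem H hH.1).2.1
      have h2 := mul_le_mul_of_nonneg_right h1 (by linarith : 0 ≤ s 𝓗 - r)
      have h3 := mul_le_mul_of_nonneg_right (hS 𝓗 hI).1 hrt
      have h4 : (n 𝓗 * (CubicTSP.withBoundaryIn F 𝓗 0).ncard) * (s 𝓗 - r) -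
          p 𝓗 * (CubicTSP.withBoundaryIn F 𝓗 (CubicTSP.evenFloor (b 𝓗))).ncard * (r - t 𝓗) ≤
          ∑ H with H ∈ 𝓗, co 𝓗 * (b 𝓗 - 1.5 * x H) := by
        rw [hwith, hwith, mul_assoc, mul_assoc, sum_mul, sum_mul, mul_sum, mul_sum,
          ← sum_sub_distrib]
        refine sum_le_sum fun H hH => ?_
        have hH' := (hmem H (mem_filter.1 hH).2).2.2
        have := hx H
        have h5 := CubicTSP.contribution_le hb (hxeven H) (by omega) hrs hbd
        simpa only [ite_mul, one_mul, zero_mul] using h5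
      linarith
    have hlin : ∑ 𝓗 ∈ J, ∑ H with H ∈ 𝓗, co 𝓗 * (b 𝓗 - 1.5 * x H) ≤ 0 := by
      have h1 : ∑ 𝓗 ∈ J, ∑ H with H ∈ 𝓗, co 𝓗 * (b 𝓗 - 1.5 * x H) =
          (3 * ∑ 𝓗 ∈ J, ∑ H with H ∈ 𝓗, co 𝓗 * CubicTSP.crossing f (vs H) -
            ∑ 𝓗 ∈ J, ∑ H with H ∈ 𝓗, co 𝓗 * #(G.interedges (vs H) (vs H)ᶜ)) / 2 := by
        simp only [mul_sum, ← sum_sub_distrib, sum_div]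
        refine sum_congr rfl fun 𝓗 h𝓗 => sum_congr rfl fun H hH => ?_
        have h2 := ((hgood 𝓗 ((hJ 𝓗).1 h𝓗).1).2 H (mem_filter.1 hH).2).2.2
        have h3 : (x H : ℝ) + CubicTSP.crossing f (vs H) = b 𝓗 := by
          rw [← h2]; exact_mod_cast hx H
        rw [← CubicTSP.ncard_boundary, hvs, h2, ← h3]
        ring
      rw [h1]
      linarith
    have htotal := (hmain.trans (sum_le_sum hcoll)).trans hlin
    rw [sum_sub_distrib, sum_const, card_univ, nsmul_eq_mul] at htotal
    linarith
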